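/- Conventions. A subset $A$ of a $T_1$-space $Z$ accumulates at $z\in Z$ if every neighborhood of $z$ contains infinitely many points of $A$. A family $\mathcal N$ of subsets of $Z$ is a $cp$-network if for every $z\in Z$, every neighborhood $O_z$ of $z$ and every $A\subset Z$ with $z\in\overline A$ there is $N\in\mathcal N$ with $z\in N\subset O_z$ such that moreover $N\cap A$ is infinite if $A$ accumulates at $z$. A $\mathfrak P_0$-space is a regular $T_1$-space with a countable $cp$-network. For topological spaces $X,Y$, $C_k(X,Y)$ is the space of continuous functions $X\to Y$ with the compact-open topology, and $\mathsf C[\mathcal M]$ is the smallest class of topological spaces that contains all metrizable spaces and is closed under taking subspaces, homeomorphic images, countable topological sums, countable Tychonoff products, and function spaces $C_k(X,Y)$ with $X$ Lindelöf. An ideal of compact subsets of $X$ is a family $\mathcal I$ of compact subsets of $X$ with $\bigcup\mathcal I=X$ such that $A\cup B\in\mathcal I$ and $A\cap K\in\mathcal I$ for all $A,B\in\mathcal I$ and all compact $K\subset X$; it is discretely-complete if for all compact $A,B\subset X$ such that $B\setminus A$ is countable and discrete (as a subspace), $A\in\mathcal I$ implies $B\in\mathcal I$. $C_{\mathcal I}(X)$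 is the set of continuous functions $X\to\mathbb R$ with the topology generated by the sets $\{f: f(K)\subset U\}$, $K\in\mathcal I$, $U\subset\mathbb R$ open. Statement. There exists a $\mathfrak P_0$-space that does not belong to $\mathsf C[\mathcal M]$. More precisely, let $X$ be any separable metrizable space that contains a topological copy of the Cantor cube $2^\omega$. Then $X$ contains an uncountable family of pairwise disjoint topological copies of $2^\omega$; and for every such family $\mathcal C$ there is a smallest discretely-complete ideal $\mathcal I$ of compact subsets of $X$ with $\mathcal C\subset\mathcal I$, and the function space $C_{\mathcal I}(X)$ is a $\mathfrak P_0$-space that does not belong to $\mathsf C[\mathcal M]$. -/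

import Mathlib

open Set Topology TopologicalSpace Filter

universe u v

/-- A class of topological spaces. -/
abbrev SpaceClass : Type (u + 1) := ∀ (X : Type u) [TopologicalSpace X], Prop

/-- Stable classes: closed under subspaces, homeomorphic images, countable topological sums and
countable Tychonoff products. -/
structure SpaceClass.IsStable (𝒳 : SpaceClass.{u}) : Prop where
  subspace : ∀ (X : Type u) [TopologicalSpace X], 𝒳 X → ∀ s : Set X, 𝒳 s
  homeomorph : ∀ (X Y : Type u) [TopologicalSpace X] [TopologicalSpace Y],
    Nonempty (X ≃ₜ Y) → 𝒳 X → 𝒳 Y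
  sigma : ∀ (ι : Type) [Countable ι] (X : ι → Type u) [∀ i, TopologicalSpace (X i)],
    (∀ i, 𝒳 (X i)) → 𝒳 (Σ i, X i)
  pi : ∀ (ι : Type) [Countable ι] (X : ι → Type u) [∀ i, TopologicalSpace (X i)],
    (∀ i, 𝒳 (X i)) → 𝒳 (∀ i, X i)

/-- Stable classes that are moreover closed under function spaces with Lindelöf domain. The
topology that Mathlib puts on `C(X, Y)` is the compact-open one. -/
structure SpaceClass.IsCkStable (𝒳 : SpaceClass.{u}) : Prop extends 𝒳.IsStable where
  functionSpace : ∀ (X Y : Type u) [TopologicalSpace X] [TopologicalSpace Y],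
    LindelofSpace X → 𝒳 X → 𝒳 Y → 𝒳 C(X, Y)

/-- The smallest class that contains `𝒳` and is closed under subspaces, homeomorphic images,
countable sums, countable products and function spaces with Lindelöf domain. -/
def SpaceClass.ckClosure (𝒳 : SpaceClass.{u}) : SpaceClass.{u} := fun X _ =>
  ∀ 𝒴 : SpaceClass.{u}, 𝒴.IsCkStable →
    (∀ (Y : Type u) [TopologicalSpace Y], 𝒳 Y → 𝒴 Y) → 𝒴 X

/-- The class of all metrizable spaces. -/
def metrizableClass : SpaceClass.{u} := fun X _ => MetrizableSpace X

/-- `cp`-networks: `AccPt x (𝓟 A)` says that the set `A` accumulates at `x`. -/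
def IsCpNetwork {X : Type u} [TopologicalSpace X] (𝒩 : Set (Set X)) : Prop :=
  ∀ x : X, ∀ O ∈ 𝓝 x, ∀ A : Set X, x ∈ closure A →
    ∃ N ∈ 𝒩, x ∈ N ∧ N ⊆ O ∧ (AccPt x (𝓟 A) → (N ∩ A).Infinite)

/-- Regular `T₁` spaces with a countable `cp`-network. -/
def IsP0Space (X : Type u) [TopologicalSpace X] : Prop :=
  T3Space X ∧ ∃ 𝒩 : Set (Set X), 𝒩.Countable ∧ IsCpNetwork 𝒩

/-- Ideals of compact sets. -/
structure IsCompactIdeal {X : Type u} [TopologicalSpace X] (I : Set (Set X)) : Prop where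
  isCompact : ∀ K ∈ I, IsCompact K
  sUnion_eq : ⋃₀ I = univ
  union_mem : ∀ A ∈ I, ∀ B ∈ I, A ∪ B ∈ I
  inter_mem : ∀ A ∈ I, ∀ K : Set X, IsCompact K → A ∩ K ∈ I

/-- Discretely-complete ideals of compact sets; `B \ A` is discrete as a subspace. -/
structure IsDiscretelyCompleteIdeal {X : Type u} [TopologicalSpace X] (I : Set (Set X)) : Prop
    extends IsCompactIdeal I where
  mem_of_diff : ∀ A B : Set X, IsCompact A → IsCompact B → (B \ A).Countable →
    DiscreteTopology ↥(B \ A) → A ∈ I → B ∈ I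

/-- The set `C(X, Y)`, to be endowed with the `I`-open topology. -/
def IdealFunctionSpace {X : Type u} [TopologicalSpace X] (_I : Set (Set X)) (Y : Type v)
    [TopologicalSpace Y] : Type (max u v) := C(X, Y)

/-- The `I`-open topology: a subbase consists of the sets `{f | f(K) ⊆ U}`, with `K` in `I`
and `U` open. -/
instance IdealFunctionSpace.topologicalSpace {X : Type u} [TopologicalSpace X] (I : Set (Set X))
    (Y : Type v) [TopologicalSpace Y] : TopologicalSpace (IdealFunctionSpace I Y) :=
  generateFrom {S : Set C(X, Y) | ∃ K ∈ I, ∃ U : Set Y, IsOpen U ∧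
    S = {f : C(X, Y) | MapsTo f K U}}

/-- Topological copies of the Cantor cube inside `X`. -/
def IsCantorCopy {X : Type u} [TopologicalSpace X] (C : Set X) : Prop :=
  Nonempty (↥C ≃ₜ (ℕ → Bool))

/-! The invariant is `embeddableClass`: embeddability into `C(A, B)` with `A` separable metrizable
and `B` metrizable. It contains the metrizable spaces and is stable under all the operations, hence
contains the closure `ckClosure`. The hard case is `C(X, Y)` with `X` Lindelöf: by
`exists_compactCovering_of_isEmbedding`, `X` is a compact-covering image of a separable metrizable
`M`, so that `C(X, Y)` embeds into `C(M, C(D, E))`, which embeds into `C(M × D, E)`.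

Suppose the ideal function space embedded into `C(A, B)`. Each `C ∈ 𝒞` gives the neighborhood `f(C)
⊆ (-∞, 1)` of zero, which is controlled by a compact `L_C ⊆ A` and some `1/(n+1)`. Uncountably many
`C` share `n`, and infinitely many of their `L_C` lie in one compact set
(`exists_infinite_subset_of_compact`). Continuity at zero then yields one `K ∈ I` containing
infinitely many `C`. This is impossible: members of the least ideal are covered, up to a countable
set, by finitely many elements of `𝒞`.

The countable `cp`-network consists of finite intersections of sets `{f | f(W) ⊆ V}` with `W`, `V`
from countable families; discrete completeness enters in `isCpNetwork`. -/

namespace ContinuousMap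

/-! ### Embeddings between function spaces -/

section Embeddings

variable {A B D X Y Z : Type*} [TopologicalSpace A] [TopologicalSpace B] [TopologicalSpace D]
  [TopologicalSpace X] [TopologicalSpace Y] [TopologicalSpace Z]

theorem isInducing_of_forall_mapsTo {φ : C(X, Y) → Z} (hφ : Continuous φ)
    (h : ∀ (K : Set X) (U : Set Y), IsCompact K → IsOpen U →
      ∃ V : Set Z, IsOpen V ∧ φ ⁻¹' V = {f : C(X, Y) | MapsTo f K U}) : IsInducing φ := by
  refine ⟨le_antisymm hφ.le_induced ?_⟩
  rw [compactOpen_eq]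
  refine le_generateFrom ?_
  rintro _ ⟨K, hK, U, hU, rfl⟩
  exact h K U hK hU

/-- If `K = p(L)`, then `f(K) ⊆ U` means `(f ∘ p)(L) ⊆ U`. -/
theorem isEmbedding_comp_of_compactCovering (p : C(X, Y)) (hp : Function.Surjective p)
    (hpc : ∀ K : Set Y, IsCompact K → ∃ L : Set X, IsCompact L ∧ p '' L = K) :
    IsEmbedding (fun f : C(Y, Z) => f.comp p) := by
  refine ⟨isInducing_of_forall_mapsTo (continuous_precomp p) fun K U hK hU => ?_, fun f g h => ?_⟩
  · obtain ⟨L, hL, rfl⟩ := hpc K hK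
    refine ⟨_, isOpen_setOfPred_mapsTo hL hU, ?_⟩
    ext f
    simp [mapsTo_image_iff]
  · ext y
    obtain ⟨x, rfl⟩ := hp y
    exact DFunLike.congr_fun h x

theorem isEmbedding_comp_of_rightInverse (p : C(X, Y)) (s : C(Y, X)) (h : ∀ y, p (s y) = y) :
    IsEmbedding (fun f : C(Y, Z) => f.comp p) :=
  isEmbedding_comp_of_compactCovering p (fun y => ⟨s y, h y⟩) fun K hK =>
    ⟨s '' K, hK.image s.continuous, by simp [image_image, h]⟩

/-- A compact subset of a sum meets only finitely many summands, so subbasic sets come from open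
boxes in the product. -/
theorem isInducing_sigma {ι : Type*} {W : ι → Type*} [∀ i, TopologicalSpace (W i)] :
    IsInducing (fun (f : C(Σ i, W i, Y)) (i : ι) => f.comp (sigmaMk i)) := by
  refine isInducing_of_forall_mapsTo
    (continuous_pi fun i => continuous_precomp (sigmaMk i)) fun K U hK hU => ?_
  obtain ⟨s, t, hs, ht, rfl⟩ := hK.sigma_exists_finite_sigma_eq
  refine ⟨s.pi fun i => {f : C(W i, Y) | MapsTo f (t i) U},
    isOpen_set_pi hs fun i _ => isOpen_setOfPred_mapsTo (ht i) hU, ?_⟩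
  ext f
  constructor
  · rintro h ⟨i, x⟩ ⟨hi, hx⟩
    exact h i hi hx
  · intro h i hi x hx
    exact h (show (⟨i, x⟩ : Σ i, W i) ∈ s.sigma t from ⟨hi, hx⟩)

theorem isEmbedding_pi {ι : Type*} {V W : ι → Type*} [∀ i, TopologicalSpace (V i)]
    [∀ i, TopologicalSpace (W i)] :
    IsEmbedding (fun f : (∀ i, C(V i, W i)) =>
      (⟨Sigma.map id fun i => f i, Continuous.sigma_map fun i => (f i).continuous⟩ : C(Σ i, V i, Σ i, W i))) := by
  have h : IsEmbedding (Pi.map fun i (f : C(V i, W i)) => (sigmaMk i : C(W i, Σ i, W i)).comp f) :=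
    .piMap fun i => isEmbedding_postcomp _ IsEmbedding.sigmaMk
  refine ⟨?_, fun f g hfg => h.injective ?_⟩
  · rw [← isInducing_sigma.of_comp_iff]
    exact h.isInducing
  · funext i
    ext1 x
    exact DFunLike.congr_fun hfg ⟨i, x⟩

/-- Extend a map by adding isolated points to the domain and to the codomain. -/
def sumUnit (f : C(X, Y)) : C(X ⊕ PUnit.{u + 1}, Y ⊕ PUnit.{v + 1}) :=
  ⟨Sum.elim (Sum.inl ∘ f) fun _ => Sum.inr PUnit.unit, by fun_prop⟩

theorem isEmbedding_sumUnit :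
    IsEmbedding (sumUnit.{u, v} : C(X, Y) → C(X ⊕ PUnit, Y ⊕ PUnit)) := by
  refine .of_comp (continuous_compactOpen.2 fun K hK U hU => ?_)
    (continuous_precomp (⟨Sum.inl, continuous_inl⟩ : C(X, X ⊕ PUnit)))
    (isEmbedding_postcomp (⟨Sum.inl, continuous_inl⟩ : C(Y, Y ⊕ PUnit)) IsEmbedding.inl)
  have : {f : C(X, Y) | MapsTo (sumUnit.{u, v} f) K U} =
      {f : C(X, Y) | MapsTo f (Sum.inl ⁻¹' K) (Sum.inl ⁻¹' U)} ∩
      {_f : C(X, Y) | ∀ x, Sum.inr x ∈ K → Sum.inr PUnit.unit ∈ U} := by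
    ext f
    constructor
    · exact fun h => ⟨fun x hx => h hx, fun x hx => h hx⟩
    · rintro ⟨h1, h2⟩ (x | x) hx
      exacts [h1 hx, h2 x hx]
  rw [this]
  exact (isOpen_setOfPred_mapsTo (IsClosedEmbedding.inl.isCompact_preimage hK)
    (hU.preimage continuous_inl)).inter isOpen_const

end Embeddings

/-! ### The exponential law without local compactness -/

section Uncurry

variable {A D E : Type*} [TopologicalSpace A] [TopologicalSpace D] [TopologicalSpace E]

/-- Continuity is tested along a convergent sequence. Its second coordinates and their limit form a
compact set, over which evaluation is jointly continuous. -/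
theorem continuous_uncurry_of_sequentialSpace [SequentialSpace (A × D)] [T2Space A] [T2Space D]
    (f : C(A, C(D, E))) : Continuous (Function.uncurry fun a d => f a d) := by
  refine continuous_iff_seqContinuous.2 fun x p hx => ?_
  let K : Set D := insert p.2 (range fun n => (x n).2)
  have hK : IsCompact K := ((continuous_snd.tendsto p).comp hx).isCompact_insert_range
  have : CompactSpace K := isCompact_iff_compactSpace.1 hK
  have h1 : Tendsto (fun n => (f (x n).1).restrict K) atTop (𝓝 ((f p.1).restrict K)) :=
    ((continuous_restrict K).comp f.continuous).continuousAt.tendsto.comp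
      ((continuous_fst.tendsto p).comp hx)
  have h2 : Tendsto (fun n => (⟨(x n).2, mem_insert_of_mem _ ⟨n, rfl⟩⟩ : K)) atTop
      (𝓝 ⟨p.2, mem_insert _ _⟩) :=
    tendsto_subtype_rng.2 ((continuous_snd.tendsto p).comp hx)
  exact ((continuous_eval (F := C(K, E))).tendsto _).comp (h1.prodMk_nhds h2)

theorem isEmbedding_uncurry {A D E : Type*} [TopologicalSpace A] [TopologicalSpace D]
    [UniformSpace E] [SequentialSpace (A × D)] [T2Space A] [T2Space D] :
    IsEmbedding (fun f : C(A, C(D, E)) =>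
      (⟨_, continuous_uncurry_of_sequentialSpace f⟩ : C(A × D, E))) := by
  refine ⟨isInducing_iff_nhds.2 fun f => ?_, fun f g h => ?_⟩
  · have key : ∀ l : Filter C(A, C(D, E)), Tendsto id l (𝓝 f) ↔
        Tendsto (fun f : C(A, C(D, E)) =>
          (⟨_, continuous_uncurry_of_sequentialSpace f⟩ : C(A × D, E))) l
        (𝓝 ⟨_, continuous_uncurry_of_sequentialSpace f⟩) := by
      intro l
      rw [tendsto_iff_forall_isCompact_tendstoUniformlyOn,
        tendsto_iff_forall_isCompact_tendstoUniformlyOn]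
      constructor
      · intro h K hK V hV
        have := h (Prod.fst '' K) (hK.image continuous_fst)
          {q | ∀ x ∈ Prod.snd '' K, (q.1 x, q.2 x) ∈ V}
          (hasBasis_compactConvergenceUniformity.mem_of_mem
            (i := (Prod.snd '' K, V)) ⟨hK.image continuous_snd, hV⟩)
        filter_upwards [this] with g hg p hp
        exact hg p.1 (mem_image_of_mem _ hp) p.2 (mem_image_of_mem _ hp)
      · intro h K hK W hW
        obtain ⟨L, V, hL, hV, hLV⟩ := (mem_compactConvergence_entourage_iff W).1 hW
        filter_upwards [h (K ×ˢ L) (hK.prod hL) V hV] with g hg a ha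
        exact hLV fun d hd => hg (a, d) ⟨ha, hd⟩
    exact le_antisymm (tendsto_iff_comap.1 ((key _).1 tendsto_id))
      ((key _).2 tendsto_comap)
  · ext a d
    exact DFunLike.congr_fun h (a, d)

end Uncurry

end ContinuousMap

/-! ### Lindelöf spaces of functions as compact-covering images -/

theorem secondCountableTopology_of_lindelofSpace (X : Type*) [TopologicalSpace X]
    [PseudoMetrizableSpace X] [LindelofSpace X] : SecondCountableTopology X := by
  let := pseudoMetrizableSpacePseudoMetric X
  refine Metric.secondCountable_of_almost_dense_set fun ε hε => ?_
  obtain ⟨s, hs, hU⟩ := countable_cover_nhds (X := X) (U := fun x => Metric.ball x ε)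
    fun x => Metric.ball_mem_nhds x hε
  refine ⟨s, hs, fun x => ?_⟩
  have hx : x ∈ ⋃ y ∈ s, Metric.ball y ε := hU ▸ mem_univ x
  obtain ⟨y, hy, hxy⟩ := mem_iUnion₂.1 hx
  exact ⟨y, hy, (Metric.mem_ball.1 hxy).le⟩

namespace ContinuousMap

/-- Equicontinuity of compact sets of functions. A failure would produce a sequence converging to
`a`; on the compact set formed by it and `a`, evaluation is jointly continuous, and compactness of
`K` gives a contradiction. -/
theorem exists_mem_nhds_dist_lt_of_isCompact {A B : Type*} [TopologicalSpace A]
    [FirstCountableTopology A] [PseudoMetricSpace B] {K : Set C(A, B)} (hK : IsCompact K) (a : A)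
    {ε : ℝ} (hε : 0 < ε) : ∀ᶠ x in 𝓝 a, ∀ f ∈ K, dist (f a) (f x) < ε := by
  by_contra hcon
  obtain ⟨V, hV⟩ := (𝓝 a).exists_antitone_basis
  have hex : ∀ n, ∃ x ∈ V n, ∃ f ∈ K, ε ≤ dist (f a) (f x) := by
    intro n
    by_contra! hn
    exact hcon (mem_of_superset (hV.1.mem_of_mem trivial) fun x hx f hf => hn x hx f hf)
  choose x hxV f hfK hf using hex
  have hx : Tendsto x atTop (𝓝 a) := hV.tendsto hxV
  let L : Set A := insert a (range x)
  have : CompactSpace L := isCompact_iff_compactSpace.1 hx.isCompact_insert_range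
  let a' : L := ⟨a, mem_insert _ _⟩
  let x' : ℕ → L := fun n => ⟨x n, mem_insert_of_mem _ ⟨n, rfl⟩⟩
  have hx' : Tendsto x' atTop (𝓝 a') := tendsto_subtype_rng.2 hx
  have hKL := hK.image (continuous_restrict (Y := B) L)
  have h := hKL.eventually_forall_of_forall_eventually
    (x₀ := a') (P := fun y g => dist (g a') (g y) < ε) fun g _ => by
      have hc : Continuous fun z : L × C(L, B) => dist (z.2 a') (z.2 z.1) := by fun_prop
      exact hc.continuousAt.eventually_lt continuousAt_const (by simpa using hε)
  obtain ⟨n, hn⟩ := (hx'.eventually h).exists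
  exact (hf n).not_gt (hn _ (mem_image_of_mem _ (hfK n)))

end ContinuousMap

/-- A function together with a system of open sets on which its oscillation is controlled. -/
structure ControlledMap {A B X : Type u} [TopologicalSpace A] [SecondCountableTopology A]
    [TopologicalSpace B] [MetricSpace B] (φ : X → C(A, B)) where
  /-- the underlying point -/
  point : X
  /-- the system of open sets -/
  control : ℕ × countableBasis A → Bool
  dist_le : ∀ (n : ℕ) (U : countableBasis A), control (n, U) = true →
    ∀ x ∈ U.1, ∀ y ∈ U.1, dist (φ point x) (φ point y) ≤ 1 / ((n : ℝ) + 1)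
  exists_mem : ∀ (n : ℕ) (a : A), ∃ U : countableBasis A, control (n, U) = true ∧ a ∈ U.1

namespace ControlledMap

variable {A B X : Type u} [TopologicalSpace A] [SecondCountableTopology A]
  [MetricSpace B] {φ : X → C(A, B)}

/-- Restriction of functions to a countable dense set. -/
def restrictDense (φ : X → C(A, B)) (x : X) : (exists_countable_dense A).choose → B :=
  fun a => φ x a

/-- The restriction of the function to a countable dense set, and the control. -/
def code (p : ControlledMap φ) :
    range (restrictDense φ) × (ℕ × countableBasis A → Bool) :=
  (⟨restrictDense φ p.point, mem_range_self _⟩, p.control)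

instance : TopologicalSpace (ControlledMap φ) := induced code inferInstance

theorem code_injective (hφ : Function.Injective φ) :
    Function.Injective (code : ControlledMap φ → _) := by
  intro p q h
  have h1 : restrictDense φ p.point = restrictDense φ q.point :=
    congrArg (fun z => z.1.1) h
  have h2 : p.control = q.control := congrArg Prod.snd h
  have h3 : p.point = q.point := by
    refine hφ (ContinuousMap.coe_injective ?_)
    exact Continuous.ext_on (exists_countable_dense A).choose_spec.2 (φ p.point).continuous
      (φ q.point).continuous fun a ha => congrFun h1 ⟨a, ha⟩
  cases p; cases q
  simp_all

theorem isInducing_code : IsInducing (code : ControlledMap φ → _) := ⟨rfl⟩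

theorem metrizableSpace (hφ : Function.Injective φ) : MetrizableSpace (ControlledMap φ) :=
  have : Countable (countableBasis A) := (countable_countableBasis A).to_subtype
  have : Countable (exists_countable_dense A).choose :=
    (exists_countable_dense A).choose_spec.1.to_subtype
  (IsEmbedding.mk isInducing_code (code_injective hφ)).metrizableSpace

theorem secondCountableTopology [TopologicalSpace X] [LindelofSpace X] (hφ : Continuous φ) :
    SecondCountableTopology (ControlledMap φ) :=
  have : Countable (countableBasis A) := (countable_countableBasis A).to_subtype
  have : Countable (exists_countable_dense A).choose :=
    (exists_countable_dense A).choose_spec.1.to_subtype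
  have h : Continuous (restrictDense φ) :=
    continuous_pi fun a => (ContinuousEvalConst.continuous_eval_const a.1).comp hφ
  have : LindelofSpace (range (restrictDense φ)) :=
    isLindelof_iff_lindelofSpace.1 (isLindelof_range h)
  have : SecondCountableTopology (range (restrictDense φ)) :=
    secondCountableTopology_of_lindelofSpace _
  isInducing_code.secondCountableTopology

/-- Points near `p` keep a given control bit, hence the oscillation bound on `U`. Closeness at one
dense point of `U` then spreads over `U` by a three-epsilon estimate. -/
theorem continuous_apply_point : Continuous fun p : ControlledMap φ => φ p.point := by
  refine continuous_iff_continuousAt.2 fun p => ?_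
  refine ContinuousMap.tendsto_of_tendstoLocallyUniformly
    (Metric.tendstoLocallyUniformly_iff.2 fun ε hε a => ?_)
  obtain ⟨n, hn⟩ := exists_nat_one_div_lt (show 0 < ε / 3 by positivity)
  obtain ⟨U, hU, haU⟩ := p.exists_mem n a
  have hUo : IsOpen U.1 := isOpen_of_mem_countableBasis U.2
  refine ⟨U.1, hUo.mem_nhds haU, ?_⟩
  obtain ⟨d, hd, hdU⟩ := (exists_countable_dense A).choose_spec.2.exists_mem_open hUo ⟨a, haU⟩
  have h1 : Continuous fun q : ControlledMap φ => q.control (n, U) :=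
    (_root_.continuous_apply _).comp (continuous_snd.comp isInducing_code.continuous)
  have h2 : Continuous fun q : ControlledMap φ => φ q.point d :=
    (_root_.continuous_apply (⟨d, hd⟩ : (exists_countable_dense A).choose)).comp
      (continuous_subtype_val.comp (continuous_fst.comp isInducing_code.continuous))
  have e1 : ∀ᶠ q in 𝓝 p, q.control (n, U) = true :=
    h1.continuousAt.eventually_mem (isOpen_discrete {true} |>.mem_nhds hU)
  have e2 : ∀ᶠ q in 𝓝 p, dist (φ p.point d) (φ q.point d) < ε / 3 :=
    (continuous_const.dist h2).continuousAt.eventually_lt continuousAt_const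
      (by simpa using hε)
  filter_upwards [e1, e2] with q hq1 hq2 y hy
  have d1 := p.dist_le n U hU y hy d hdU
  have d2 := q.dist_le n U hq1 d hdU y hy
  have := dist_triangle4 (φ p.point y) (φ p.point d) (φ q.point d) (φ q.point y)
  linarith

/-- By equicontinuity a single control `c` serves all of `K`; with the control held constant, `K`
lifts continuously. -/
theorem exists_compact_image_point_eq [TopologicalSpace X] (hφ : Continuous φ) {K : Set X}
    (hK : IsCompact K) :
    ∃ L : Set (ControlledMap φ), IsCompact L ∧ point '' L = K := by
  classical
  let c : ℕ × countableBasis A → Bool := fun z => decide (∀ f ∈ K, ∀ x ∈ z.2.1, ∀ y ∈ z.2.1,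
    dist (φ f x) (φ f y) ≤ 1 / ((z.1 : ℝ) + 1))
  have hc : ∀ (n : ℕ) (a : A), ∃ U : countableBasis A, c (n, U) = true ∧ a ∈ U.1 := by
    intro n a
    have h := ContinuousMap.exists_mem_nhds_dist_lt_of_isCompact (hK.image hφ) a
      (ε := 1 / ((n : ℝ) + 1) / 2) (by positivity)
    obtain ⟨U, hU, haU, hUs⟩ := (isBasis_countableBasis A).mem_nhds_iff.1 h
    refine ⟨⟨U, hU⟩, decide_eq_true fun f hf x hx y hy => ?_, haU⟩
    have h1 := hUs hx (φ f) (mem_image_of_mem _ hf)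
    have h2 := hUs hy (φ f) (mem_image_of_mem _ hf)
    have := dist_triangle_left (φ f x) (φ f y) (φ f a)
    linarith
  let s : K → ControlledMap φ := fun f =>
    ⟨f, c, fun n U hU x hx y hy => of_decide_eq_true hU f f.2 x hx y hy, hc⟩
  have hs : Continuous s := by
    refine isInducing_code.continuous_iff.2 (Continuous.prodMk ?_ continuous_const)
    refine Continuous.subtype_mk (continuous_pi fun a => ?_) _
    exact (ContinuousEvalConst.continuous_eval_const a.1).comp (hφ.comp continuous_subtype_val)
  have : CompactSpace K := isCompact_iff_compactSpace.1 hK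
  refine ⟨range s, isCompact_range hs, ?_⟩
  rw [← range_comp]
  exact Subtype.range_val

end ControlledMap

theorem exists_compactCovering_of_isEmbedding {A B X : Type u} [TopologicalSpace A]
    [SecondCountableTopology A] [TopologicalSpace B] [MetrizableSpace B] [TopologicalSpace X]
    [LindelofSpace X] {φ : X → C(A, B)} (hφ : IsEmbedding φ) :
    ∃ (M : Type u) (_ : TopologicalSpace M) (p : C(M, X)), MetrizableSpace M ∧
      SecondCountableTopology M ∧ Function.Surjective p ∧
      ∀ K : Set X, IsCompact K → ∃ L : Set M, IsCompact L ∧ p '' L = K := by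
  let := metrizableSpaceMetric B
  have hc := fun (K : Set X) (hK : IsCompact K) =>
    ControlledMap.exists_compact_image_point_eq hφ.continuous hK
  refine ⟨ControlledMap φ, inferInstance, ⟨ControlledMap.point,
    hφ.continuous_iff.2 ControlledMap.continuous_apply_point⟩,
    ControlledMap.metrizableSpace hφ.injective,
    ControlledMap.secondCountableTopology hφ.continuous, fun x => ?_, hc⟩
  obtain ⟨L, -, hL⟩ := hc {x} isCompact_singleton
  have hx : x ∈ ControlledMap.point '' L := hL ▸ mem_singleton x
  obtain ⟨p, -, hp⟩ := hx
  exact ⟨p, hp⟩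

/-! ### The invariant class and its stability -/

/-- Spaces that embed into `C(A, B)` for a separable metrizable space `A` and a metrizable
space `B`. -/
def embeddableClass : SpaceClass.{u} := fun Z _ =>
  ∃ (A B : Type u) (_ : TopologicalSpace A) (_ : TopologicalSpace B),
    MetrizableSpace A ∧ SecondCountableTopology A ∧ MetrizableSpace B ∧
    ∃ φ : Z → C(A, B), IsEmbedding φ

theorem embeddableClass_of_isEmbedding {Z W : Type u} [TopologicalSpace Z] [TopologicalSpace W]
    {f : Z → W} (hf : IsEmbedding f) (hW : embeddableClass W) : embeddableClass Z := by
  obtain ⟨A, B, _, _, hA, hA', hB, φ, hφ⟩ := hW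
  exact ⟨A, B, _, _, hA, hA', hB, φ ∘ f, hφ.comp hf⟩

theorem metrizableSpace_sigma {ι : Type*} {X : ι → Type*} [∀ i, TopologicalSpace (X i)]
    [∀ i, MetrizableSpace (X i)] : MetrizableSpace (Σ i, X i) := by
  let := fun i => metrizableSpaceMetric (X i)
  let := Metric.Sigma.metricSpace (E := X)
  infer_instance

theorem metrizableSpace_sum {X Y : Type*} [TopologicalSpace X] [TopologicalSpace Y]
    [MetrizableSpace X] [MetrizableSpace Y] : MetrizableSpace (X ⊕ Y) := by
  let := metrizableSpaceMetric X
  let := metrizableSpaceMetric Y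
  let := Metric.metricSpaceSum (X := X) (Y := Y)
  infer_instance

open Classical in
/-- The retraction of a sum onto one summand, with an isolated point added. -/
noncomputable def sigmaRetraction {ι : Type*} (X : ι → Type*) [∀ i, TopologicalSpace (X i)]
    (i : ι) : C(Σ j, X j ⊕ PUnit.{v + 1}, X i ⊕ PUnit.{v + 1}) where
  toFun p := if h : p.1 = i then h ▸ p.2 else Sum.inr PUnit.unit
  continuous_toFun := by
    refine continuous_sigma fun j => ?_
    by_cases h : j = i
    · subst h
      simp only [dite_true]
      exact continuous_id
    · simpa [h] using continuous_const

theorem sigmaRetraction_mk {ι : Type*} (X : ι → Type*) [∀ i, TopologicalSpace (X i)] (i : ι)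
    (x : X i ⊕ PUnit.{v + 1}) : sigmaRetraction X i ⟨i, x⟩ = x := by
  simp [sigmaRetraction]

/-- All summands need a common domain, so `φ i z` is precomposed with a retraction of the whole sum
onto the `i`-th summand. The added points receive the other summands, and make this work when `A i`
is empty. -/
theorem embeddableClass_sigma {ι : Type} [Countable ι] (Z : ι → Type u)
    [∀ i, TopologicalSpace (Z i)] (h : ∀ i, embeddableClass (Z i)) :
    embeddableClass (Σ i, Z i) := by
  choose A B tA tB hA hA' hB φ hφ using h
  rcases isEmpty_or_nonempty ι with hι | ⟨⟨i₀⟩⟩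
  · refine ⟨PUnit, PUnit, inferInstance, inferInstance, inferInstance, inferInstance,
      inferInstance, isEmptyElim, .of_subsingleton _⟩
  have : ∀ i, MetrizableSpace (A i ⊕ PUnit.{u + 1}) := fun i => metrizableSpace_sum
  have : ∀ i, MetrizableSpace (B i ⊕ PUnit.{u + 1}) := fun i => metrizableSpace_sum
  have : Nonempty (Σ i, A i ⊕ PUnit.{u + 1}) := ⟨⟨i₀, Sum.inr PUnit.unit⟩⟩
  refine ⟨Σ i, A i ⊕ PUnit.{u + 1}, Σ i, B i ⊕ PUnit.{u + 1}, inferInstance, inferInstance,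
    metrizableSpace_sigma, inferInstance, metrizableSpace_sigma, _,
    ContinuousMap.isEmbedding_sigmaMk_comp.comp
      ((isEmbedding_sigmaMap (f₁ := id) (f₂ := fun i z =>
        (ContinuousMap.sumUnit.{u, u} (φ i z)).comp (sigmaRetraction.{u} A i))
        Function.injective_id).2 fun i => ?_)⟩
  exact ((ContinuousMap.isEmbedding_comp_of_rightInverse (sigmaRetraction.{u} A i)
    (ContinuousMap.sigmaMk (X := fun j => A j ⊕ PUnit) i) (sigmaRetraction_mk A i)).comp
    ContinuousMap.isEmbedding_sumUnit).comp (hφ i)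

theorem embeddableClass_pi {ι : Type} [Countable ι] (Z : ι → Type u)
    [∀ i, TopologicalSpace (Z i)] (h : ∀ i, embeddableClass (Z i)) :
    embeddableClass (∀ i, Z i) := by
  choose A B tA tB hA hA' hB φ hφ using h
  exact ⟨Σ i, A i, Σ i, B i, inferInstance, inferInstance, metrizableSpace_sigma, inferInstance,
    metrizableSpace_sigma, _, ContinuousMap.isEmbedding_pi.comp (.piMap hφ)⟩

theorem embeddableClass_functionSpace (X Y : Type u) [TopologicalSpace X] [TopologicalSpace Y]
    [LindelofSpace X] (hX : embeddableClass X) (hY : embeddableClass Y) :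
    embeddableClass C(X, Y) := by
  obtain ⟨A, B, _, _, hA, hA', hB, φ, hφ⟩ := hX
  obtain ⟨D, E, _, _, hD, hD', hE, ψ, hψ⟩ := hY
  obtain ⟨M, _, p, hM, hM', hp, hpc⟩ := exists_compactCovering_of_isEmbedding hφ
  let := metrizableSpaceMetric E
  exact ⟨M × D, E, inferInstance, inferInstance, inferInstance, inferInstance, inferInstance, _,
    ContinuousMap.isEmbedding_uncurry.comp
      ((ContinuousMap.isEmbedding_postcomp ⟨ψ, hψ.continuous⟩ hψ).comp
        (ContinuousMap.isEmbedding_comp_of_compactCovering p hp hpc))⟩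

theorem embeddableClass_isCkStable : embeddableClass.{u}.IsCkStable where
  subspace _ _ hX _ := embeddableClass_of_isEmbedding .subtypeVal hX
  homeomorph _ _ _ _ e hX := embeddableClass_of_isEmbedding e.some.symm.isEmbedding hX
  sigma _ _ := embeddableClass_sigma
  pi _ _ := embeddableClass_pi
  functionSpace X Y _ _ _ := embeddableClass_functionSpace X Y

theorem embeddableClass_of_metrizableSpace (Y : Type u) [TopologicalSpace Y] [MetrizableSpace Y] :
    embeddableClass Y :=
  ⟨PUnit, Y, inferInstance, inferInstance, inferInstance, inferInstance, inferInstance, _,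
    (Homeomorph.continuousMapOfUnique (X := PUnit.{u + 1}) (Y := Y)).isEmbedding⟩

theorem embeddableClass_of_ckClosure {Z : Type u} [TopologicalSpace Z]
    (h : metrizableClass.ckClosure Z) : embeddableClass Z :=
  h _ embeddableClass_isCkStable fun Y _ hY =>
    have : MetrizableSpace Y := hY
    embeddableClass_of_metrizableSpace Y

/-! ### Sets converging to a compact set -/

section Compact

variable {X : Type*} [TopologicalSpace X]

theorem exists_countable_compact_basis (X : Type*) [TopologicalSpace X]
    [SecondCountableTopology X] :
    ∃ 𝒲 : Set (Set X), 𝒲.Countable ∧ (∀ W ∈ 𝒲, IsOpen W) ∧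
      ∀ K V : Set X, IsCompact K → IsOpen V → K ⊆ V → ∃ W ∈ 𝒲, K ⊆ W ∧ W ⊆ V := by
  refine ⟨sUnion '' {s | s.Finite ∧ s ⊆ countableBasis X},
    (countable_ofPred_finite_subset (countable_countableBasis X)).image _, ?_, ?_⟩
  · rintro _ ⟨s, ⟨-, hs⟩, rfl⟩
    exact isOpen_sUnion fun t ht => isOpen_of_mem_countableBasis (hs ht)
  · intro K V hK hV hKV
    refine hK.induction_on (p := fun K' => ∃ W ∈ sUnion '' {s | s.Finite ∧ s ⊆ countableBasis X},
      K' ⊆ W ∧ W ⊆ V) ?_ ?_ ?_ ?_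
    · exact ⟨∅, ⟨∅, ⟨finite_empty, empty_subset _⟩, sUnion_empty⟩, subset_rfl, empty_subset _⟩
    · rintro s t hst ⟨W, hW, h1, h2⟩
      exact ⟨W, hW, hst.trans h1, h2⟩
    · rintro s t ⟨_, ⟨a, ha, rfl⟩, h1, h2⟩ ⟨_, ⟨b, hb, rfl⟩, h3, h4⟩
      exact ⟨_, ⟨a ∪ b, ⟨ha.1.union hb.1, union_subset ha.2 hb.2⟩, sUnion_union a b⟩,
        union_subset_union h1 h3, union_subset h2 h4⟩
    · intro x hx
      obtain ⟨U, hU, hxU, hUV⟩ := (isBasis_countableBasis X).mem_nhds_iff.1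
        (hV.mem_nhds (hKV hx))
      exact ⟨U, mem_nhdsWithin_of_mem_nhds ((isOpen_of_mem_countableBasis hU).mem_nhds hxU),
        U, ⟨{U}, ⟨finite_singleton U, singleton_subset_iff.2 hU⟩, sUnion_singleton U⟩,
        subset_rfl, hUV⟩

/-- A finite subcover of `K` already covers all but finitely many `P n`. -/
theorem IsCompact.union_iUnion_of_eventually_subset {K : Set X} {P : ℕ → Set X} (hK : IsCompact K)
    (hP : ∀ n, IsCompact (P n)) (h : ∀ V, IsOpen V → K ⊆ V → ∀ᶠ n in atTop, P n ⊆ V) :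
    IsCompact (K ∪ ⋃ n, P n) := by
  classical
  refine isCompact_of_finite_subcover fun U hU hcov => ?_
  obtain ⟨t, ht⟩ := hK.elim_finite_subcover U hU (subset_union_left.trans hcov)
  obtain ⟨N, hN⟩ := eventually_atTop.1 (h _ (isOpen_biUnion fun i _ => hU i) ht)
  have hc : IsCompact (⋃ n ∈ Finset.range N, P n) :=
    (Finset.range N).isCompact_biUnion fun n _ => hP n
  obtain ⟨t', ht'⟩ := hc.elim_finite_subcover U hU
    ((iUnion₂_subset fun n _ => subset_iUnion P n).trans (subset_union_right.trans hcov))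
  refine ⟨t ∪ t', union_subset (ht.trans (biUnion_subset_biUnion_left fun i hi =>
    Finset.mem_union_left _ hi)) (iUnion_subset fun n => ?_)⟩
  rcases lt_or_ge n N with hn | hn
  · exact (subset_biUnion_of_mem (u := P) (Finset.mem_coe.2 (Finset.mem_range.2 hn))).trans
      (ht'.trans (biUnion_subset_biUnion_left fun i hi => Finset.mem_union_right _ hi))
  · exact (hN n hn).trans (biUnion_subset_biUnion_left fun i hi => Finset.mem_union_left _ hi)

/-- A point off `K` has a neighborhood separated from `K`, which meets only finitely many of the
finite sets `P n`. -/
theorem IsCompact.discreteTopology_iUnion_diff [T2Space X] {K : Set X} {P : ℕ → Set X}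
    (hK : IsCompact K) (hP : ∀ n, (P n).Finite)
    (h : ∀ V, IsOpen V → K ⊆ V → ∀ᶠ n in atTop, P n ⊆ V) :
    DiscreteTopology ↥((K ∪ ⋃ n, P n) \ K) := by
  refine discreteTopology_of_noAccPts fun x hx hacc => ?_
  obtain ⟨V, O, hV, hO, hKV, hxO, hVO⟩ :=
    SeparatedNhds.of_isCompact_isCompact hK isCompact_singleton
      (disjoint_singleton_right.2 hx.2)
  obtain ⟨N, hN⟩ := eventually_atTop.1 (h V hV hKV)
  have hinf := Set.Infinite.of_accPt (hacc.nhds_inter (hO.mem_nhds (hxO rfl)))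
  refine hinf (((finite_lt_nat N).biUnion fun n _ => hP n).subset ?_)
  rintro y ⟨hyO, hy, hyK⟩
  obtain ⟨n, hn⟩ := mem_iUnion.1 (hy.resolve_left hyK)
  refine mem_biUnion (x := n) (mem_ofPred.2 (lt_of_not_ge fun hNn => ?_)) hn
  exact hVO.ne_of_mem (hN n hNn hn) hyO rfl

theorem IsCompact.exists_seq_subset_of_compact_basis [MetrizableSpace X] {𝒲 : Set (Set X)}
    (h𝒲 : ∀ K V : Set X, IsCompact K → IsOpen V → K ⊆ V → ∃ W ∈ 𝒲, K ⊆ W ∧ W ⊆ V)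
    {K V : Set X} (hK : IsCompact K) (hV : IsOpen V) (hKV : K ⊆ V) :
    ∃ W : ℕ → Set X, (∀ n, W n ∈ 𝒲 ∧ K ⊆ W n ∧ W n ⊆ V) ∧
      ∀ U, IsOpen U → K ⊆ U → ∀ᶠ n in atTop, W n ⊆ U := by
  let := metrizableSpaceMetric X
  have h : ∀ n : ℕ, ∃ W ∈ 𝒲, K ⊆ W ∧ W ⊆ Metric.thickening (1 / ((n : ℝ) + 1)) K ∩ V := fun n =>
    h𝒲 _ _ hK (Metric.isOpen_thickening.inter hV)
      (subset_inter (Metric.self_subset_thickening (by positivity) K) hKV)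
  choose W hW hKW hWV using h
  refine ⟨W, fun n => ⟨hW n, hKW n, (hWV n).trans inter_subset_right⟩, fun U hU hKU => ?_⟩
  obtain ⟨δ, hδ, hδU⟩ := hK.exists_thickening_subset_open hU hKU
  filter_upwards [tendsto_one_div_add_atTop_nhds_zero_nat.eventually_lt_const hδ] with n hn
  exact ((hWV n).trans inter_subset_left).trans ((Metric.thickening_mono hn.le K).trans hδU)

end Compact

/-! ### The countable `cp`-network -/

namespace IdealFunctionSpace

variable {X : Type u} {Y : Type v} [TopologicalSpace X] [TopologicalSpace Y] {I : Set (Set X)}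

/-- The underlying continuous map. -/
def toContinuousMap (f : IdealFunctionSpace I Y) : C(X, Y) := f

theorem isOpen_setOf_mapsTo {K : Set X} {U : Set Y} (hK : K ∈ I) (hU : IsOpen U) :
    IsOpen {f : IdealFunctionSpace I Y | MapsTo f.toContinuousMap K U} :=
  isOpen_generateFrom_of_mem ⟨K, hK, U, hU, rfl⟩

theorem exists_finite_of_mem_nhds {f : IdealFunctionSpace I Y} {O : Set (IdealFunctionSpace I Y)}
    (hO : O ∈ 𝓝 f) :
    ∃ (T : Set (Set (IdealFunctionSpace I Y))) (K : T → Set X) (U : T → Set Y), T.Finite ∧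
      (∀ i, K i ∈ I ∧ IsOpen (U i) ∧ MapsTo f.toContinuousMap (K i) (U i)) ∧
      ∀ g : IdealFunctionSpace I Y, (∀ i, MapsTo g.toContinuousMap (K i) (U i)) → g ∈ O := by
  obtain ⟨_, ⟨T, ⟨hT, hTs⟩, rfl⟩, hfT, hTO⟩ :=
    (isTopologicalBasis_of_subbasis (t := IdealFunctionSpace.topologicalSpace I Y)
      rfl).mem_nhds_iff.1 hO
  have h : ∀ i : T, ∃ K ∈ I, ∃ U : Set Y, IsOpen U ∧
      i.1 = {g : IdealFunctionSpace I Y | MapsTo g.toContinuousMap K U} := fun i => hTs i.2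
  choose K hK U hU h using h
  refine ⟨T, K, U, hT, fun i => ⟨hK i, hU i, ?_⟩, fun g hg => hTO fun S hS => ?_⟩
  · have := hfT i.1 i.2
    rwa [h i] at this
  · have := hg ⟨S, hS⟩
    rw [show S = _ from h ⟨S, hS⟩]
    exact this

/-- Restriction to the members of `I` embeds the space into a product of compact-open function
spaces. -/
theorem t3Space [T3Space Y] (hI : IsCompactIdeal I) : T3Space (IdealFunctionSpace I Y) := by
  let ρ : IdealFunctionSpace I Y → ∀ K : I, C(K.1, Y) := fun f K => f.toContinuousMap.restrict K
  have hρ : IsInducing ρ := by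
    refine ⟨le_antisymm ?_ (le_generateFrom ?_)⟩
    · refine continuous_iff_le_induced.1 (continuous_pi fun K => ?_)
      refine ContinuousMap.continuous_compactOpen.2 fun L hL U hU => ?_
      have hm := hI.inter_mem K.1 K.2 _ (hL.image continuous_subtype_val)
      convert isOpen_setOf_mapsTo (I := I) hm hU using 1
      ext f
      constructor
      · rintro h _ ⟨-, x, hx, rfl⟩
        exact h hx
      · exact fun h x hx => h ⟨x.2, x, hx, rfl⟩
    · rintro _ ⟨K, hK, U, hU, rfl⟩
      have : CompactSpace K := isCompact_iff_compactSpace.1 (hI.isCompact K hK)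
      have hc : Continuous fun g : (∀ K : I, C(K.1, Y)) => g ⟨K, hK⟩ := continuous_apply _
      refine ⟨_, (ContinuousMap.isOpen_setOfPred_mapsTo isCompact_univ hU).preimage hc, ?_⟩
      ext f
      constructor
      · exact fun h x hx => h (mem_univ (⟨x, hx⟩ : K))
      · exact fun h x _ => h x.2
  refine IsEmbedding.t3Space (f := ρ) ⟨hρ, fun f g hfg => ?_⟩
  refine ContinuousMap.ext fun x => ?_
  obtain ⟨K, hK, hx⟩ : x ∈ ⋃₀ I := hI.sUnion_eq ▸ mem_univ x
  exact DFunLike.congr_fun (congrFun hfg ⟨K, hK⟩) (⟨x, hx⟩ : K)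

/-- Functions that map one of finitely many sets into another. -/
def mapsToAll (I : Set (Set X)) (s : Set (Set X × Set Y)) : Set (IdealFunctionSpace I Y) :=
  {f | ∀ p ∈ s, MapsTo f.toContinuousMap p.1 p.2}

/-- With `W i n` shrinking to `K i`, suppose every `N n ∩ A` is finite. Then finitely many witnesses
per level enlarge each `K i` to some `K' i`, still in `I` by discrete completeness. Every `g ∈ A`
mapping all `K' i` into `U i` is forced into `N 0`, so `A` cannot accumulate at `f`. -/
theorem isCpNetwork [MetrizableSpace X] [T1Space (IdealFunctionSpace I Y)]
    (hI : IsDiscretelyCompleteIdeal I) {𝒲 : Set (Set X)} {𝒱 : Set (Set Y)}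
    (h𝒲 : ∀ K V : Set X, IsCompact K → IsOpen V → K ⊆ V → ∃ W ∈ 𝒲, K ⊆ W ∧ W ⊆ V)
    (h𝒱o : ∀ V ∈ 𝒱, IsOpen V)
    (h𝒱 : ∀ K V : Set Y, IsCompact K → IsOpen V → K ⊆ V → ∃ W ∈ 𝒱, K ⊆ W ∧ W ⊆ V) :
    IsCpNetwork (mapsToAll I '' {s : Set (Set X × Set Y) | s.Finite ∧ s ⊆ 𝒲 ×ˢ 𝒱}) := by
  intro f O hO A _
  obtain ⟨T, K, U', hT, hK, hTO⟩ := exists_finite_of_mem_nhds hO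
  have : Finite T := hT
  have hKc : ∀ i, IsCompact (K i) := fun i => hI.isCompact _ (hK i).1
  have hU : ∀ i, ∃ U ∈ 𝒱, f.toContinuousMap '' K i ⊆ U ∧ U ⊆ U' i := fun i =>
    h𝒱 _ _ ((hKc i).image f.toContinuousMap.continuous) (hK i).2.1 (hK i).2.2.image_subset
  choose U hU hfU hUU' using hU
  have hUo := fun i => h𝒱o _ (hU i)
  have hW := fun i => (hKc i).exists_seq_subset_of_compact_basis h𝒲
    ((hUo i).preimage f.toContinuousMap.continuous) (image_subset_iff.1 (hfU i))
  choose W hW hWU using hW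
  let N : ℕ → Set (IdealFunctionSpace I Y) := fun n => mapsToAll I (range fun i => (W i n, U i))
  have hN : ∀ n g, g ∈ N n ↔ ∀ i, MapsTo g.toContinuousMap (W i n) (U i) := fun n g =>
    forall_mem_range
  have hNmem : ∀ n,
      N n ∈ mapsToAll I '' {s : Set (Set X × Set Y) | s.Finite ∧ s ⊆ 𝒲 ×ˢ 𝒱} := fun n =>
    ⟨_, ⟨finite_range _, range_subset_iff.2 fun i => ⟨(hW i n).1, hU i⟩⟩, rfl⟩
  have hfN : ∀ n, f ∈ N n := fun n => (hN n f).2 fun i => (hW i n).2.2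
  have hNO : ∀ n, N n ⊆ O := fun n g hg => hTO g fun i =>
    (((hN n g).1 hg i).mono_left (hW i n).2.1).mono_right (hUU' i)
  by_cases hacc : AccPt f (𝓟 A)
  swap
  · exact ⟨N 0, hNmem 0, hfN 0, hNO 0, fun h => absurd h hacc⟩
  suffices ∃ n, (N n ∩ A).Infinite by
    obtain ⟨n, hn⟩ := this
    exact ⟨N n, hNmem n, hfN n, hNO n, fun _ => hn⟩
  by_contra! hfin
  have hpt : ∀ i n (g : IdealFunctionSpace I Y), ∃ s : Set X, s.Finite ∧ s ⊆ W i n ∧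
      (MapsTo g.toContinuousMap s (U i) → MapsTo g.toContinuousMap (W i n) (U i)) := by
    intro i n g
    by_cases h : ∃ x ∈ W i n, g.toContinuousMap x ∉ U i
    · obtain ⟨x, hx, hgx⟩ := h
      exact ⟨{x}, finite_singleton x, singleton_subset_iff.2 hx, fun h => absurd (h rfl) hgx⟩
    · push Not at h
      exact ⟨∅, finite_empty, empty_subset _, fun _ => h⟩
  choose pt hptf hptW hpt using hpt
  -- Points of `W i n` where members of `N (n + 1) ∩ A` leave `U i`: the index shift lets these
  -- points force a descent from `N (n + 1)` to `N n`.
  let P : T → ℕ → Set X := fun i n => ⋃ g ∈ N (n + 1) ∩ A, pt i n g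
  have hPfin : ∀ i n, (P i n).Finite := fun i n =>
    (hfin (n + 1)).biUnion fun g _ => hptf i n g
  have hPW : ∀ i n, P i n ⊆ W i n := fun i n => iUnion₂_subset fun g _ => hptW i n g
  have hPU : ∀ i V, IsOpen V → K i ⊆ V → ∀ᶠ n in atTop, P i n ⊆ V := fun i V hV hKV =>
    (hWU i V hV hKV).mono fun n hn => (hPW i n).trans hn
  let K' : T → Set X := fun i => K i ∪ ⋃ n, P i n
  have hK' : ∀ i, K' i ∈ I := fun i =>
    hI.mem_of_diff (K i) (K' i) (hKc i)
      ((hKc i).union_iUnion_of_eventually_subset (fun n => (hPfin i n).isCompact) (hPU i))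
      ((countable_iUnion fun n => (hPfin i n).countable).mono
        (sdiff_subset_iff.2 subset_rfl))
      ((hKc i).discreteTopology_iUnion_diff (hPfin i) (hPU i)) (hK i).1
  have hQ : {g : IdealFunctionSpace I Y | ∀ i, MapsTo g.toContinuousMap (K' i) (U i)} ∈ 𝓝 f := by
    rw [ofPred_forall]
    refine (isOpen_iInter_of_finite fun i => isOpen_setOf_mapsTo (hK' i) (hUo i)).mem_nhds
      (mem_iInter.2 fun i x hx => ?_)
    rcases hx with hx | hx
    · exact hfU i (mem_image_of_mem _ hx)
    · obtain ⟨n, hn⟩ := mem_iUnion.1 hx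
      exact (hW i n).2.2 (hPW i n hn)
  refine Set.Infinite.of_accPt (hacc.nhds_inter hQ) ((hfin 0).subset ?_)
  rintro g ⟨hg, hgA⟩
  refine ⟨?_, hgA⟩
  -- The sets `W i n` eventually enter the open set `g⁻¹(U i) ⊇ K i`; the descent `hstep` then leads
  -- down to `N 0`.
  have hev : ∀ᶠ n in atTop, g ∈ N n := by
    simp only [hN]
    refine eventually_all.2 fun i => ?_
    exact hWU i _ ((hUo i).preimage g.toContinuousMap.continuous) fun x hx => hg i (Or.inl hx)
  have hstep : ∀ n, g ∈ N (n + 1) → g ∈ N n := by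
    intro n hn
    refine (hN n g).2 fun i => hpt i n g fun x hx => hg i (Or.inr (mem_iUnion.2 ⟨n, ?_⟩))
    exact mem_biUnion (x := g) ⟨hn, hgA⟩ hx
  obtain ⟨n, hn⟩ := hev.exists
  induction n with
  | zero => exact hn
  | succ n ih => exact ih (hstep n hn)

theorem isP0Space [MetrizableSpace X] [SecondCountableTopology X] [T3Space Y]
    [SecondCountableTopology Y] (hI : IsDiscretelyCompleteIdeal I) :
    IsP0Space (IdealFunctionSpace I Y) := by
  obtain ⟨𝒲, h𝒲c, -, h𝒲⟩ := exists_countable_compact_basis X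
  obtain ⟨𝒱, h𝒱c, h𝒱o, h𝒱⟩ := exists_countable_compact_basis Y
  have := t3Space (Y := Y) hI.toIsCompactIdeal
  exact ⟨this, _, (countable_ofPred_finite_subset (h𝒲c.prod h𝒱c)).image _,
    isCpNetwork hI h𝒲 h𝒱o h𝒱⟩

end IdealFunctionSpace

/-! ### The obstruction to embedding -/

/-- Some `L c₀` is a limit of the others: `σ c k` lists the sets among the first `k` of the
countable family that contain `L c`. If each `c` had a `k` with `V (σ c k)` finite, these countably
many finite sets would cover `T`. Distinct indices chosen from `V (σ c₀ k)` with growing `k` give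
sets converging to `L c₀`, whose union with `L c₀` is compact. -/
theorem exists_infinite_subset_of_compact {ι M : Type*} [TopologicalSpace M]
    [SecondCountableTopology M] {T : Set ι} (hT : ¬ T.Countable) {L : ι → Set M}
    (hL : ∀ i, IsCompact (L i)) :
    ∃ S ⊆ T, S.Infinite ∧ ∃ L' : Set M, IsCompact L' ∧ ∀ i ∈ S, L i ⊆ L' := by
  classical
  obtain ⟨𝒲, h𝒲c, -, h𝒲⟩ := exists_countable_compact_basis M
  obtain ⟨W₀, hW₀, -⟩ := h𝒲 ∅ ∅ isCompact_empty isOpen_empty subset_rfl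
  obtain ⟨w, rfl⟩ := h𝒲c.exists_eq_range ⟨W₀, hW₀⟩
  let V : Finset ℕ → Set ι := fun s => {i ∈ T | ∀ j ∈ s, L i ⊆ w j}
  let σ : ι → ℕ → Finset ℕ := fun i k => {j ∈ Finset.range k | L i ⊆ w j}
  obtain ⟨c₀, hc₀⟩ : ∃ c, ∀ k, (V (σ c k)).Infinite := by
    by_contra! h
    refine hT (((to_countable {s : Finset ℕ | (V s).Finite}).biUnion
      fun s hs => Set.Finite.countable hs).mono fun c hc => ?_)
    obtain ⟨k, hk⟩ := h c
    exact mem_biUnion (x := σ c k) hk ⟨hc, fun j hj => (Finset.mem_filter.1 hj).2⟩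
  obtain ⟨p, hpV, hp⟩ := exists_seq_of_forall_finset_exists
    (fun p : ι × ℕ => p.1 ∈ V (σ c₀ p.2)) (fun p q => p.1 ≠ q.1 ∧ p.2 < q.2) fun s _ => by
      let k := s.sup Prod.snd + 1
      obtain ⟨i, hi, his⟩ := (hc₀ k).exists_notMem_finset (s.image Prod.fst)
      exact ⟨(i, k), hi, fun x hx =>
        ⟨fun h => his (Finset.mem_image.2 ⟨x, hx, h⟩), Nat.lt_succ_of_le (Finset.le_sup hx)⟩⟩
  have hmono : StrictMono fun n => (p n).2 := fun m n h => (hp m n h).2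
  have hinj : Function.Injective fun n => (p n).1 :=
    .of_lt_imp_ne fun m n h => (hp m n h).1
  refine ⟨range fun n => (p n).1, range_subset_iff.2 fun n => (hpV n).1,
    infinite_range_of_injective hinj, L c₀ ∪ ⋃ n, L (p n).1,
    (hL c₀).union_iUnion_of_eventually_subset (fun n => hL _) fun U hU hLU => ?_, ?_⟩
  · obtain ⟨_, ⟨j, rfl⟩, h1, h2⟩ := h𝒲 _ U (hL c₀) hU hLU
    filter_upwards [eventually_gt_atTop j] with n hn
    refine ((hpV n).2 j (Finset.mem_filter.2 ⟨Finset.mem_range.2 ?_, h1⟩)).trans h2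
    exact hn.trans_le hmono.le_apply
  · rintro _ ⟨n, rfl⟩
    exact subset_union_of_subset_right (subset_iUnion (fun n => L (p n).1) n) _

theorem exists_fiber_not_countable {ι : Type*} {T : Set ι} (hT : ¬ T.Countable) (n : ι → ℕ) :
    ∃ k, ¬ {i ∈ T | n i = k}.Countable := by
  by_contra! h
  refine hT ((countable_iUnion h).mono fun i hi => mem_iUnion.2 ⟨n i, ?_⟩)
  exact ⟨hi, rfl⟩

namespace IdealFunctionSpace

variable {X : Type u} [TopologicalSpace X] {I 𝒞 : Set (Set X)}

theorem exists_dist_lt_of_isInducing {Z A B : Type*} [TopologicalSpace Z] [TopologicalSpace A]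
    [PseudoMetricSpace B] {φ : Z → C(A, B)} (hφ : IsInducing φ) {z : Z} {V : Set Z} (hV : V ∈ 𝓝 z) :
    ∃ (L : Set A) (n : ℕ), IsCompact L ∧
      ∀ y, (∀ a ∈ L, dist (φ y a) (φ z a) < 1 / ((n : ℝ) + 1)) → y ∈ V := by
  have hb := (nhds_basis_uniformity (x := φ z)
    (Metric.uniformity_basis_dist_inv_nat_succ (α := B)).compactConvergenceUniformity).comap φ
  rw [← hφ.nhds_eq_comap] at hb
  obtain ⟨⟨L, n⟩, ⟨hL, -⟩, h⟩ := hb.mem_iff.1 hV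
  exact ⟨L, n, hL, fun y hy => h hy⟩

theorem not_embeddableClass [MetrizableSpace X] (hI : IsCompactIdeal I) (h𝒞I : 𝒞 ⊆ I)
    (h𝒞 : ¬ 𝒞.Countable) (hfin : ∀ K ∈ I, {C ∈ 𝒞 | C ⊆ K}.Finite) :
    ¬ embeddableClass (IdealFunctionSpace I ℝ) := by
  rintro ⟨A, B, _, _, hA, hA', hB, φ, hφ⟩
  let := metrizableSpaceMetric B
  let z : IdealFunctionSpace I ℝ := (0 : C(X, ℝ))
  have h : ∀ C : 𝒞, ∃ (L : Set A) (n : ℕ), IsCompact L ∧ ∀ f : IdealFunctionSpace I ℝ,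
      (∀ a ∈ L, dist (φ f a) (φ z a) < 1 / ((n : ℝ) + 1)) →
      MapsTo f.toContinuousMap C.1 (Iio 1) := fun C =>
    exists_dist_lt_of_isInducing hφ.isInducing
      ((isOpen_setOf_mapsTo (h𝒞I C.2) isOpen_Iio).mem_nhds
        (fun x _ => (zero_lt_one : (0 : ℝ) < 1)))
  choose L n hL hn using h
  have huniv : ¬ (univ : Set 𝒞).Countable := fun h => h𝒞 (countable_univ_iff.1 h).to_set
  obtain ⟨k, hk⟩ := exists_fiber_not_countable huniv n
  obtain ⟨S, hS, hSinf, L', hL', hLL'⟩ := exists_infinite_subset_of_compact hk hL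
  have hO : {f : IdealFunctionSpace I ℝ | ∀ a ∈ L', dist (φ f a) (φ z a) < 1 / ((k : ℝ) + 1)} ∈
      𝓝 z := by
    have := (ContinuousMap.tendsto_iff_forall_isCompact_tendstoUniformlyOn.1
      (hφ.continuous.tendsto z)) L' hL'
    filter_upwards [Metric.tendstoUniformlyOn_iff.1 this (1 / ((k : ℝ) + 1)) (by positivity)]
      with f hf a ha
    rw [dist_comm]
    exact hf a ha
  obtain ⟨T, K, U, hT, hK, hTO⟩ := exists_finite_of_mem_nhds hO
  have hIne : I.Nonempty := by
    obtain ⟨C, -⟩ := hSinf.nonempty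
    exact ⟨C, h𝒞I C.2⟩
  have hKI : ∃ K' ∈ I, ∀ i, K i ⊆ K' := by
    have : Finite T := hT
    have := hIne.to_subtype
    have hd : Directed (· ⊆ ·) (Subtype.val : I → Set X) := fun A B =>
      ⟨⟨A ∪ B, hI.union_mem A A.2 B B.2⟩, subset_union_left, subset_union_right⟩
    obtain ⟨M, hM⟩ := hd.finite_le fun i => ⟨K i, (hK i).1⟩
    exact ⟨M, M.2, hM⟩
  obtain ⟨K', hK', hKK'⟩ := hKI
  -- Every `C ∈ S` lies in `K'`: for `x ∈ C \ K'`, a Urysohn function vanishing on `K'` with value 1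
  -- at `x` would be in the neighborhood `hO` of zero, hence below 1 on `C`.
  refine hSinf (((hfin K' hK').preimage Subtype.val_injective.injOn).subset fun C hC => ?_)
  refine ⟨C.2, fun x hx => ?_⟩
  by_contra hxK
  obtain ⟨f, hf0, hf1, -⟩ := exists_continuous_zero_one_of_isClosed
    (hI.isCompact K' hK').isClosed isClosed_singleton (disjoint_singleton_right.2 hxK)
  have hfO : ∀ a ∈ L', dist (φ f a) (φ z a) < 1 / ((k : ℝ) + 1) :=
    hTO f fun i y hy => by
      have h0 : f y = 0 := hf0 (hKK' i hy)
      have h1 : z.toContinuousMap y ∈ U i := (hK i).2.2 hy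
      change f y ∈ U i
      rw [h0]
      exact h1
  have hlt : f x < 1 := hn C f (fun a ha => by
    rw [(hS hC).2]
    exact hfO a (hLL' C hC ha)) hx
  exact hlt.ne (hf1 rfl)

end IdealFunctionSpace

/-! ### Discretely-complete ideals -/

section Ideals

variable {X : Type u} [TopologicalSpace X]

theorem IsCompactIdeal.singleton_mem {I : Set (Set X)} (hI : IsCompactIdeal I) (x : X) :
    {x} ∈ I := by
  obtain ⟨K, hK, hx⟩ : x ∈ ⋃₀ I := hI.sUnion_eq ▸ mem_univ x
  have := hI.inter_mem K hK {x} isCompact_singleton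
  rwa [inter_eq_right.2 (singleton_subset_iff.2 hx)] at this

theorem isDiscretelyCompleteIdeal_sInter {𝒥 : Set (Set (Set X))} (hne : 𝒥.Nonempty)
    (h : ∀ J ∈ 𝒥, IsDiscretelyCompleteIdeal J) : IsDiscretelyCompleteIdeal (⋂₀ 𝒥) where
  isCompact K hK := by
    obtain ⟨J, hJ⟩ := hne
    exact (h J hJ).isCompact K (hK J hJ)
  sUnion_eq := eq_univ_of_forall fun x =>
    ⟨{x}, fun J hJ => (h J hJ).toIsCompactIdeal.singleton_mem x, rfl⟩
  union_mem A hA B hB J hJ := (h J hJ).union_mem A (hA J hJ) B (hB J hJ)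
  inter_mem A hA K hK J hJ := (h J hJ).inter_mem A (hA J hJ) K hK
  mem_of_diff A B hA hB hc hd hAI J hJ := (h J hJ).mem_of_diff A B hA hB hc hd (hAI J hJ)

/-- Compact sets that are covered up to a countable set by finitely many members of a family. -/
def almostCovered (𝒞 : Set (Set X)) : Set (Set X) :=
  {K | IsCompact K ∧ ∃ F ⊆ 𝒞, F.Finite ∧ (K \ ⋃₀ F).Countable}

/-- This ideal serves as an upper bound for the least one, which needs no explicit description. -/
theorem isDiscretelyCompleteIdeal_almostCovered [T2Space X] (𝒞 : Set (Set X)) :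
    IsDiscretelyCompleteIdeal (almostCovered 𝒞) where
  isCompact K hK := hK.1
  sUnion_eq := eq_univ_of_forall fun x => ⟨{x}, ⟨isCompact_singleton, ∅, empty_subset _,
    finite_empty, (countable_singleton x).mono sdiff_subset⟩, rfl⟩
  union_mem := by
    rintro A ⟨hA, F, hF, hFf, hFc⟩ B ⟨hB, G, hG, hGf, hGc⟩
    refine ⟨hA.union hB, F ∪ G, union_subset hF hG, hFf.union hGf, (hFc.union hGc).mono ?_⟩
    rw [sUnion_union]
    rintro x ⟨hx | hx, hn⟩
    exacts [Or.inl ⟨hx, fun h => hn (Or.inl h)⟩, Or.inr ⟨hx, fun h => hn (Or.inr h)⟩]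
  inter_mem := by
    rintro A ⟨hA, F, hF, hFf, hFc⟩ K hK
    exact ⟨hA.inter hK, F, hF, hFf, hFc.mono (sdiff_subset_sdiff_left inter_subset_left)⟩
  mem_of_diff := by
    rintro A B - hB hc - ⟨-, F, hF, hFf, hFc⟩
    refine ⟨hB, F, hF, hFf, (hc.union hFc).mono ?_⟩
    rintro x ⟨hx, hn⟩
    by_cases hA : x ∈ A
    exacts [Or.inr ⟨hA, hn⟩, Or.inl ⟨hx, hA⟩]

/-- A member of `𝒞` outside `F` is disjoint from `⋃₀ F`; inside `K` it would be countable. -/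
theorem finite_setOf_subset_of_mem_almostCovered {𝒞 : Set (Set X)} (hd : 𝒞.PairwiseDisjoint id)
    (hunc : ∀ C ∈ 𝒞, ¬ C.Countable) {K : Set X} (hK : K ∈ almostCovered 𝒞) :
    {C ∈ 𝒞 | C ⊆ K}.Finite := by
  obtain ⟨-, F, hF, hFf, hFc⟩ := hK
  refine hFf.subset ?_
  rintro C ⟨hC, hCK⟩
  by_contra hCF
  refine hunc C hC (hFc.mono fun x hx => ?_)
  refine ⟨hCK hx, ?_⟩
  rintro ⟨D, hD, hxD⟩
  exact (hd hC (hF hD) fun h => hCF (h ▸ hD)).ne_of_mem hx hxD rfl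

theorem subset_almostCovered {𝒞 : Set (Set X)} (hc : ∀ C ∈ 𝒞, IsCompact C) :
    𝒞 ⊆ almostCovered 𝒞 := fun C hC =>
  ⟨hc C hC, {C}, singleton_subset_iff.2 hC, finite_singleton C, by simp⟩

end Ideals

/-! ### Copies of the Cantor cube -/

section Cantor

variable {X : Type u} [TopologicalSpace X] {C : Set X}

theorem IsCantorCopy.isCompact (h : IsCantorCopy C) : IsCompact C :=
  have := h.some.symm.compactSpace
  isCompact_iff_compactSpace.2 this

theorem uncountable_cantorCube : Uncountable (ℕ → Bool) := by
  rw [← Cardinal.aleph0_lt_mk_iff]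
  simpa using Cardinal.cantor Cardinal.aleph0

theorem IsCantorCopy.not_countable (h : IsCantorCopy C) : ¬ C.Countable := fun hc =>
  have := hc.to_subtype
  have := uncountable_cantorCube
  _root_.not_countable (h.some.symm.injective.countable)

/-- The cube is homeomorphic to its square, whose vertical fibers are the required copies. -/
theorem IsCantorCopy.exists_uncountable_pairwiseDisjoint (h : IsCantorCopy C) :
    ∃ 𝒞 : Set (Set X), ¬ 𝒞.Countable ∧ 𝒞.PairwiseDisjoint id ∧ ∀ D ∈ 𝒞, IsCantorCopy D := by
  let e : (ℕ → Bool) × (ℕ → Bool) ≃ₜ (ℕ → Bool) :=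
    Homeomorph.sumArrowHomeomorphProdArrow.symm.trans
      (Homeomorph.piCongrLeft (Y := fun _ => Bool) Equiv.natSumNatEquivNat)
  let j : (ℕ → Bool) × (ℕ → Bool) → X := fun p => h.some.symm (e p)
  have hj : IsEmbedding j :=
    IsEmbedding.subtypeVal.comp (h.some.symm.isEmbedding.comp e.isEmbedding)
  let D : (ℕ → Bool) → Set X := fun a => range fun b => j (a, b)
  have hD : ∀ a b, a ≠ b → Disjoint (D a) (D b) := by
    intro a b hab
    refine disjoint_left.2 ?_
    rintro _ ⟨x, rfl⟩ ⟨y, hy⟩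
    exact hab (congrArg Prod.fst (hj.injective hy)).symm
  have hinj : Function.Injective D := by
    intro a b hab
    by_contra hne
    have := hD a b hne
    rw [hab, disjoint_self] at this
    exact (range_nonempty fun y => j (b, y)).ne_empty this
  refine ⟨range D, fun hc => ?_, ?_, ?_⟩
  · have := uncountable_cantorCube
    have := hc.to_subtype
    exact _root_.not_countable ((rangeFactorization_injective.2 hinj).countable)
  · rintro _ ⟨a, rfl⟩ _ ⟨b, rfl⟩ hab
    exact hD a b fun h => hab (h ▸ rfl)
  · rintro _ ⟨a, rfl⟩
    have ha : IsEmbedding fun b => j (a, b) := hj.comp (isEmbedding_prodMkRight a)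
    exact ⟨ha.toHomeomorph.symm⟩

end Cantor

/-! ### Conclusion -/

theorem exists_isLeast_ideal_not_ckClosure {X : Type u} [TopologicalSpace X] [MetrizableSpace X]
    [SeparableSpace X] {𝒞 : Set (Set X)} (h𝒞 : ¬ 𝒞.Countable) (hd : 𝒞.PairwiseDisjoint id)
    (hc : ∀ C ∈ 𝒞, IsCantorCopy C) :
    ∃ I : Set (Set X), IsLeast {J : Set (Set X) | IsDiscretelyCompleteIdeal J ∧ 𝒞 ⊆ J} I ∧
      IsP0Space (IdealFunctionSpace I ℝ) ∧
      ¬ metrizableClass.ckClosure (IdealFunctionSpace I ℝ) := by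
  have : SecondCountableTopology X :=
    let := metrizableSpaceMetric X
    UniformSpace.secondCountable_of_separable X
  let 𝒥 : Set (Set (Set X)) := {J | IsDiscretelyCompleteIdeal J ∧ 𝒞 ⊆ J}
  have hJ : almostCovered 𝒞 ∈ 𝒥 := ⟨isDiscretelyCompleteIdeal_almostCovered 𝒞,
    subset_almostCovered fun C hC => (hc C hC).isCompact⟩
  have hI : IsDiscretelyCompleteIdeal (⋂₀ 𝒥) :=
    isDiscretelyCompleteIdeal_sInter ⟨_, hJ⟩ fun J hJ => hJ.1
  have h𝒞I : 𝒞 ⊆ ⋂₀ 𝒥 := subset_sInter fun J hJ => hJ.2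
  refine ⟨⋂₀ 𝒥, ⟨⟨hI, h𝒞I⟩, fun J hJ => sInter_subset_of_mem hJ⟩,
    IdealFunctionSpace.isP0Space hI, fun hck => ?_⟩
  exact IdealFunctionSpace.not_embeddableClass hI.toIsCompactIdeal h𝒞I h𝒞
    (fun K hK => finite_setOf_subset_of_mem_almostCovered hd
      (fun C hC => (hc C hC).not_countable) (hK _ hJ)) (embeddableClass_of_ckClosure hck)

theorem mainTheorem10 :
    (∃ (Z : Type u) (_ : TopologicalSpace Z), IsP0Space Z ∧ ¬ metrizableClass.ckClosure Z) ∧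
    ∀ (X : Type u) [TopologicalSpace X] [MetrizableSpace X] [SeparableSpace X],
      (∃ C : Set X, IsCantorCopy C) →
      (∃ 𝒞 : Set (Set X), ¬ 𝒞.Countable ∧ 𝒞.PairwiseDisjoint id ∧ ∀ C ∈ 𝒞, IsCantorCopy C) ∧
      ∀ 𝒞 : Set (Set X), ¬ 𝒞.Countable → 𝒞.PairwiseDisjoint id → (∀ C ∈ 𝒞, IsCantorCopy C) →
        ∃ I : Set (Set X),
          IsLeast {J : Set (Set X) | IsDiscretelyCompleteIdeal J ∧ 𝒞 ⊆ J} I ∧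
          IsP0Space (IdealFunctionSpace I ℝ) ∧
          ¬ metrizableClass.ckClosure (IdealFunctionSpace I ℝ) := by
  refine ⟨?_, fun X _ _ _ ⟨C, hC⟩ => ⟨hC.exists_uncountable_pairwiseDisjoint,
    fun 𝒞 => exists_isLeast_ideal_not_ckClosure⟩⟩
  -- The Cantor cube itself, lifted to the universe `u`, provides the example.
  have hC : IsCantorCopy (univ : Set (ULift.{u} (ℕ → Bool))) :=
    ⟨(Homeomorph.Set.univ _).trans Homeomorph.ulift⟩
  have : MetrizableSpace (ULift.{u} (ℕ → Bool)) := Homeomorph.ulift.isEmbedding.metrizableSpace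
  have : SeparableSpace (ULift.{u} (ℕ → Bool)) :=
    Homeomorph.ulift.symm.surjective.denseRange.separableSpace Homeomorph.ulift.symm.continuous
  obtain ⟨𝒞, h, hd, hc⟩ := hC.exists_uncountable_pairwiseDisjoint
  obtain ⟨I, -, hI⟩ := exists_isLeast_ideal_not_ckClosure h hd hc
  exact ⟨IdealFunctionSpace I ℝ, _, hI⟩
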